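/- Let $G=(V,E)$ be a finite graph with $n=|V|$, let $(C_1,\dots,C_n)$ be a partial $k$-coloring of $G$ (pairwise disjoint stable sets with $C_i=\emptyset$ for $i>k$), and let $1\le k_0$ and $k\le k_0\le n$. Let $U$ be the set of uncolored vertices and, for $v\in U$, let $F(v)\subseteq\{1,\dots,n\}$ be the set of colors $i$ such that no neighbor of $v$ lies in $C_i$. Let $U$ be the disjoint union of $U^0,U^1,\dots,U^l$ ($l\ge 0$), where $U^1,\dots,U^l$ are pairwise nonadjacent cliques. Consider the directed network with node set $U\cup F\cup C$, where $C=\{1,\dots,k_0\}$, $F=F^0\cup\dots\cup F^l$ and $F^j=\{f^j(i): i\in C\}$ is a copy of $C$. Its arcs are $A_2=\{(v,f^j(i)) : v\in U^j,\ i\in F(v)\cap C\}$ and $A_3=\{(f^j(i),i)\}$. Put $F^C=F^1\cup\dots\cup F^l$. Write $e(X,Y)$ for the number of arcs from $X$ to $Y$, $\delta^+(v)$ for the set of out-neighbors of $v$, and $\delta^-(W)$ for the set of nodes with an arc into $W$. The flow problem is called feasible if there is a real vector $x\ge 0$ on $A_2\cup A_3$ with $$\sum_{f:\,uf\in A_2}x_{uf}=1\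 (u\in U),\qquad x_{fi}=\sum_{u:\,uf\in A_2}x_{uf}\ (fi\in A_3),\qquad \Big\lfloor\frac n{k_0}\Big\rfloor-|C_i|\le\sum_{f:\,fi\in A_3}x_{fi}\le\Big\lceil\frac n{k_0}\Big\rceil-|C_i|\ (i\in C),$$ and $x\le 1$ on the arcs of $A_2$ and on the arcs leaving $F^C$, $x\le|U^0|$ on the arcs leaving $F^0$. For $R_+\subseteq U$, $S_+\subseteq F$, $T_+\subseteq C$, the positive Hall condition induced by $(R_+,S_+,T_+)$ is $$0\le |R_+|+\sum_{i\in T_+}\Big(-\Big\lfloor\frac n{k_0}\Big\rfloor+|C_i|\Big)+e(U\setminus R_+,S_+)+e(F^C\setminus S_+,T_+)+|U^0|\,e(F^0\setminus S_+,T_+).$$ Put $R_+(S_+)=\{v\in U:\delta^+(v)\cap S_+\ne\emptyset\}$ and $R_-(S_-)=\{v\in U:\delta^+(v)\subseteq S_-\}$. Call $(S_+,T_+)$ a restricted choice if $T_+\neq\emptyset$, $S_+\subseteq\delta^-(T_+)$ and $S_+\cap F^0=\delta^-(T_+)\cap F^0$. Then: 1. For all $R_+\subseteq U$, $S_+\subseteq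 F$ and $\emptyset\ne T_+\subseteq C$ there is $S'$ such that $(S',T_+)$ is a restricted choice and the right-hand side of the positive Hall condition induced by $(R_+(S'),S',T_+)$ is at most that of the one induced by $(R_+,S_+,T_+)$. 2. For a restricted choice $(S_+,T_+)$, the positive Hall condition induced by $(R_+(S_+),S_+,T_+)$ is equivalent to $$\sum_{i\in T_+}\Big(\Big\lfloor\frac n{k_0}\Big\rfloor-|C_i|\Big)\le |R_+(S_+)|+e(F^C\setminus S_+,T_+).\qquad(*)$$ 3. All positive Hall conditions hold if and only if $(*)$ holds for all restricted choices. 4. The flow problem is feasible if and only if the following three families of conditions hold: (a) $(*)$ for all restricted choices $(S_+,T_+)$; (b) $|R_-(S_-)|\le|S_-|$ for all $S_-$ contained in some $F^j$, $1\le j\le l$, and for $S_-=\emptyset$; (c) $|R_-(S_-)|+\sum_{i\in T_-}\big(-\lceil n/k_0\rceil+|C_i|\big)\le e(S_-\cap F^C,C\setminus T_-)$ for all $\emptyset\neq T_-\subseteq C$ and all $S_-\subseteq F$ with $S_-\supseteq\delta^-(T_-)$ and $S_-\cap F^0=\delta^-(T_-)\cap F^0$. -/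

import Mathlib

namespace EquitableFlow

open Finset

/-- A partial `k`-coloring of `G`: classes `C_1, …, C_n` with `n = |V|` (indexed here from `0`), which
are pairwise disjoint stable sets, those with index beyond `k` being empty. -/
structure PartialColoring {V : Type*} [Fintype V] (G : SimpleGraph V) (k : ℕ) where
  cls : Fin (Fintype.card V) → Finset V
  disjoint : ∀ i j, i ≠ j → Disjoint (cls i) (cls j)
  empty_of_le : ∀ i, k ≤ i.val → cls i = ∅
  stable : ∀ i, G.IsIndepSet (cls i : Set V)

section Coloring

variable {V : Type*} [Fintype V] {G : SimpleGraph V} {k : ℕ}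

open Classical in
/-- The set `U` of uncolored vertices. -/
noncomputable def PartialColoring.uncolored (P : PartialColoring G k) : Finset V :=
  univ.filter fun v => ∀ i, v ∉ P.cls i

open Classical in
/-- The forbidden colors `D(v)`: the colors of the colored neighbors of `v`. -/
noncomputable def PartialColoring.forbidden (P : PartialColoring G k) (v : V) :
    Finset (Fin (Fintype.card V)) :=
  univ.filter fun i => ∃ w ∈ P.cls i, G.Adj w v

open Classical in
/-- The free colors `F(v)`: all colors that are not forbidden. -/
noncomputable def PartialColoring.free (P : PartialColoring G k) (v : V) :
    Finset (Fin (Fintype.card V)) :=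
  univ \ P.forbidden v

/-- A decomposition of the uncolored vertices into pairwise nonadjacent cliques `U^1, …, U^l` and a
set `U^0` of remaining vertices. -/
structure Decomposition (P : PartialColoring G k) (l : ℕ) where
  part : Fin (l + 1) → Finset V
  disjoint : ∀ i j, i ≠ j → Disjoint (part i) (part j)
  mem_uncolored_iff : ∀ v, v ∈ P.uncolored ↔ ∃ j, v ∈ part j
  clique : ∀ j, j ≠ 0 → G.IsClique (part j : Set V)
  nonadjacent : ∀ i j, i ≠ 0 → j ≠ 0 → i ≠ j → ∀ u ∈ part i, ∀ v ∈ part j, ¬ G.Adj u v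

end Coloring

/-- The intermediate nodes of the network: `(j, i)` is the copy `f^j(i)` of color `i` in `F^j`. -/
abbrev FNode (l k₀ : ℕ) : Type := Fin (l + 1) × Fin k₀

open Classical in
/-- `F^C`, the union of the `F^j` belonging to the cliques. -/
noncomputable def cliqueNodes (l k₀ : ℕ) : Finset (FNode l k₀) := univ.filter fun f => f.1 ≠ 0

open Classical in
/-- `F^0`, the copy of the colors belonging to the remaining vertices `U^0`. -/
noncomputable def restNodes (l k₀ : ℕ) : Finset (FNode l k₀) := univ.filter fun f => f.1 = 0

open Classical in
/-- `e(X, Y)`: the number of arcs going from `X` to `Y`. -/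
noncomputable def arcCount {α β : Type*} (A : α → β → Prop) (X : Finset α) (Y : Finset β) : ℕ :=
  ((X ×ˢ Y).filter fun p => A p.1 p.2).card

/-- The arcs of `A_3`, from `F` to the colors: `f^j(i)` is joined to `i`. -/
def Arc₃ {l k₀ : ℕ} (f : FNode l k₀) (i : Fin k₀) : Prop := f.2 = i

open Classical in
/-- `δ⁻(T)` for a set `T` of colors. -/
noncomputable def inNbrs {l k₀ : ℕ} (T : Finset (Fin k₀)) : Finset (FNode l k₀) :=
  univ.filter fun f => ∃ i ∈ T, Arc₃ f i

section Network

variable {V : Type*} [Fintype V] {G : SimpleGraph V} {k l k₀ : ℕ} {P : PartialColoring G k}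

/-- The arcs of `A_2`, from `U` to `F`: `v ∈ U^j` is joined to `f^j(i)` for `i ∈ F(v)`. -/
def Arc₂ (D : Decomposition P l) (hk₀ : k₀ ≤ Fintype.card V) (v : V) (f : FNode l k₀) : Prop :=
  v ∈ D.part f.1 ∧ Fin.castLE hk₀ f.2 ∈ P.free v

open Classical in
/-- `δ⁺(v)` for an uncolored vertex `v`. -/
noncomputable def outNbrs (D : Decomposition P l) (hk₀ : k₀ ≤ Fintype.card V) (v : V) :
    Finset (FNode l k₀) :=
  univ.filter fun f => Arc₂ D hk₀ v f

/-- `⌊n / k₀⌋ - |C_i|`. -/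
noncomputable def lowerNeed (P : PartialColoring G k) (hk₀ : k₀ ≤ Fintype.card V) (i : Fin k₀) : ℤ :=
  ⌊(Fintype.card V : ℚ) / (k₀ : ℚ)⌋ - ((P.cls (Fin.castLE hk₀ i)).card : ℤ)

/-- `⌈n / k₀⌉ - |C_i|`. -/
noncomputable def upperNeed (P : PartialColoring G k) (hk₀ : k₀ ≤ Fintype.card V) (i : Fin k₀) : ℤ :=
  ⌈(Fintype.card V : ℚ) / (k₀ : ℚ)⌉ - ((P.cls (Fin.castLE hk₀ i)).card : ℤ)

open Classical in
/-- The flow problem (the network without source and sink) has a real solution: `x` is the flow on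
`A_2` and `y` the flow on `A_3`; values off the arcs are never used. -/
def Feasible (D : Decomposition P l) (hk₀ : k₀ ≤ Fintype.card V) : Prop :=
  ∃ (x : V → FNode l k₀ → ℝ) (y : FNode l k₀ → Fin k₀ → ℝ),
    (∀ u ∈ P.uncolored, ∑ f with Arc₂ D hk₀ u f, x u f = 1) ∧
    (∀ f i, Arc₃ f i → y f i - ∑ u ∈ P.uncolored with Arc₂ D hk₀ u f, x u f = 0) ∧
    (∀ i, (lowerNeed P hk₀ i : ℝ) ≤ ∑ f with Arc₃ f i, y f i ∧
      ∑ f with Arc₃ f i, y f i ≤ (upperNeed P hk₀ i : ℝ)) ∧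
    (∀ u ∈ P.uncolored, ∀ f, Arc₂ D hk₀ u f → 0 ≤ x u f ∧ x u f ≤ 1) ∧
    (∀ f ∈ cliqueNodes l k₀, ∀ i, Arc₃ f i → 0 ≤ y f i ∧ y f i ≤ 1) ∧
    (∀ f ∈ restNodes l k₀, ∀ i, Arc₃ f i → 0 ≤ y f i ∧ y f i ≤ ((D.part 0).card : ℝ))

open Classical in
/-- The right-hand side of the positive Hall condition `0 ≤ …` induced by `R_+`, `S_+`, `T_+`. -/
noncomputable def posHallRhs (D : Decomposition P l) (hk₀ : k₀ ≤ Fintype.card V)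
    (R : Finset V) (S : Finset (FNode l k₀)) (T : Finset (Fin k₀)) : ℤ :=
  (R.card : ℤ) + ∑ i ∈ T, -(lowerNeed P hk₀ i)
    + (arcCount (Arc₂ D hk₀) (P.uncolored \ R) S : ℤ)
    + (arcCount Arc₃ (cliqueNodes l k₀ \ S) T : ℤ)
    + ((D.part 0).card : ℤ) * (arcCount Arc₃ (restNodes l k₀ \ S) T : ℤ)

open Classical in
/-- `R_+` as determined by `S_+`: the uncolored vertices having an arc into `S_+`. -/
noncomputable def posR (D : Decomposition P l) (hk₀ : k₀ ≤ Fintype.card V)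
    (S : Finset (FNode l k₀)) : Finset V :=
  P.uncolored.filter fun v => (outNbrs D hk₀ v ∩ S).Nonempty

open Classical in
/-- `R_-` as determined by `S_-`: the uncolored vertices all of whose arcs lead into `S_-`. -/
noncomputable def negR (D : Decomposition P l) (hk₀ : k₀ ≤ Fintype.card V)
    (S : Finset (FNode l k₀)) : Finset V :=
  P.uncolored.filter fun v => outNbrs D hk₀ v ⊆ S

open Classical in
/-- The restricted choices: `T_+ ≠ ∅`, `S_+ ⊆ δ⁻(T_+)` and `S_+ ∩ F^0 = δ⁻(T_+) ∩ F^0`. -/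
def PosChoice (S : Finset (FNode l k₀)) (T : Finset (Fin k₀)) : Prop :=
  T.Nonempty ∧ S ⊆ inNbrs T ∧ S ∩ restNodes l k₀ = inNbrs T ∩ restNodes l k₀

open Classical in
/-- The reduced positive condition `∑_{i ∈ T_+} (⌊n/k₀⌋ - |C_i|) ≤ |R_+| + e(F^C \ S_+, T_+)`. -/
def PosCondition (D : Decomposition P l) (hk₀ : k₀ ≤ Fintype.card V)
    (S : Finset (FNode l k₀)) (T : Finset (Fin k₀)) : Prop :=
  ∑ i ∈ T, lowerNeed P hk₀ i ≤
    ((posR D hk₀ S).card : ℤ) + (arcCount Arc₃ (cliqueNodes l k₀ \ S) T : ℤ)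

/-- First family: the reduced positive conditions for all restricted choices. -/
def FamilyPos (D : Decomposition P l) (hk₀ : k₀ ≤ Fintype.card V) : Prop :=
  ∀ (S : Finset (FNode l k₀)) (T : Finset (Fin k₀)), PosChoice S T → PosCondition D hk₀ S T

/-- Second family: `|R_-| ≤ |S_-|` for all `S_-` contained in some `F^j` with `1 ≤ j ≤ l`, and for
`S_- = ∅` (which is such a subset unless `l = 0`). -/
def FamilyClique (D : Decomposition P l) (hk₀ : k₀ ≤ Fintype.card V) : Prop :=
  ∀ S : Finset (FNode l k₀), (S = ∅ ∨ ∃ j : Fin (l + 1), j ≠ 0 ∧ ∀ f ∈ S, f.1 = j) →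
    (negR D hk₀ S).card ≤ S.card

open Classical in
/-- Third family: `|R_-| - ∑_{i ∈ T_-} (⌈n/k₀⌉ - |C_i|) ≤ e(S_- ∩ F^C, C \ T_-)` for all `T_- ≠ ∅`
and `S_- ⊇ δ⁻(T_-)` with `S_- ∩ F^0 = δ⁻(T_-) ∩ F^0`. -/
def FamilyNeg (D : Decomposition P l) (hk₀ : k₀ ≤ Fintype.card V) : Prop :=
  ∀ (S : Finset (FNode l k₀)) (T : Finset (Fin k₀)), T.Nonempty → inNbrs T ⊆ S →
    S ∩ restNodes l k₀ = inNbrs T ∩ restNodes l k₀ →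
    ((negR D hk₀ S).card : ℤ) + ∑ i ∈ T, -(upperNeed P hk₀ i) ≤
      (arcCount Arc₃ (S ∩ cliqueNodes l k₀) (univ \ T) : ℤ)

end Network

end EquitableFlow

/-! Adding a root with an arc to every vertex (bounds `1`, `1` on `U`) and an arc from every color
(bounds the lower and upper need, possibly negative) turns the flow problem into a circulation
problem. By Hoffman's theorem (`exists_circulation`) it is solvable once no node set `X` has more
forced inflow than outflow capacity. Only root arcs can have nonzero lower bounds, so the cuts with
the root in `X` are the positive Hall conditions and those with the root outside are the negative
ones (`cut_of_families`).

Both kinds reduce to the stated families by normalizing the cut. Given `S`, the best set of vertices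
is `posR` or `negR`, because each wrongly placed vertex pays for at least one cut arc. On `F^0` the
set `S` may be made to agree with `δ⁻(T)`: a single wrongly placed node there already costs `|U^0|`,
which covers every vertex that correcting it can affect (`exists_posChoice_le`,
`negHall_of_families`).

Conversely, a flow yields each family by bounding the mass that passes through a set of intermediate
nodes. -/

namespace EquitableFlow

open Finset

/-! ### Hoffman's circulation theorem by minimizing the squared excess. -/

section Circulation

variable {N A : Type*} [DecidableEq N] [Fintype A]

/-- The net inflow of `x` into the node `v`. -/
def excess (src tgt : A → N) (x : A → ℝ) (v : N) : ℝ :=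
  ∑ a, x a * ((if tgt a = v then 1 else 0) - (if src a = v then 1 else 0))

theorem excess_add_smul (src tgt : A → N) (x y : A → ℝ) (t : ℝ) (v : N) :
    excess src tgt (fun a => x a + t * y a) v = excess src tgt x v + t * excess src tgt y v := by
  simp only [excess, mul_sum, ← sum_add_distrib]
  exact sum_congr rfl fun a _ => by ring

variable [Fintype N]

/-- Summation by parts. It is used with `p` the excess itself (gradient), `p = 1` (total excess
zero) and `p` an indicator (flow across a cut). -/
theorem sum_mul_excess (src tgt : A → N) (x : A → ℝ) (p : N → ℝ) :
    ∑ v, p v * excess src tgt x v = ∑ a, x a * (p (tgt a) - p (src a)) := by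
  simp only [excess, mul_sum]
  rw [sum_comm]
  refine sum_congr rfl fun a _ => ?_
  have h : ∀ v, p v * (x a * ((if tgt a = v then (1 : ℝ) else 0) - (if src a = v then 1 else 0)))
      = (if tgt a = v then x a * p v else 0) - (if src a = v then x a * p v else 0) := by
    intro v
    split_ifs <;> ring
  simp only [h, sum_sub_distrib, sum_ite_eq, mem_univ, if_true]
  ring

/-- First order optimality for the total squared excess on a box. -/
theorem exists_excess_stationary (src tgt : A → N) (lo up : A → ℝ) (hle : ∀ a, lo a ≤ up a) :
    ∃ x ∈ Set.Icc lo up, ∀ y ∈ Set.Icc lo up,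
      0 ≤ ∑ a, (y a - x a) * (excess src tgt x (tgt a) - excess src tgt x (src a)) := by
  have hcont : Continuous fun x : A → ℝ => ∑ v, excess src tgt x v ^ 2 := by
    unfold excess
    fun_prop
  obtain ⟨x, hx, hmin⟩ := (isCompact_Icc (a := lo) (b := up)).exists_isMinOn
    ⟨lo, le_refl lo, hle⟩ hcont.continuousOn
  refine ⟨x, hx, fun y hy => ?_⟩
  rw [← sum_mul_excess src tgt (fun a => y a - x a)]
  set B := ∑ v, excess src tgt x v * excess src tgt (fun a => y a - x a) v with hB
  set C := ∑ v, excess src tgt (fun a => y a - x a) v ^ 2 with hC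
  have hC0 : 0 ≤ C := sum_nonneg fun v _ => sq_nonneg _
  have key : ∀ t : ℝ, 0 ≤ t → t ≤ 1 → 0 ≤ 2 * t * B + t ^ 2 * C := by
    intro t ht0 ht1
    have hmem : (fun a => x a + t * (y a - x a)) ∈ Set.Icc lo up := by
      constructor <;> intro a
      · have h1 := hx.1 a
        have h2 := hy.1 a
        simp only
        nlinarith
      · have h1 := hx.2 a
        have h2 := hy.2 a
        simp only
        nlinarith
    have h : ∑ v, excess src tgt x v ^ 2 ≤
        ∑ v, excess src tgt (fun a => x a + t * (y a - x a)) v ^ 2 := hmin hmem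
    have heq : ∑ v, excess src tgt (fun a => x a + t * (y a - x a)) v ^ 2
        = ∑ v, excess src tgt x v ^ 2 + (2 * t * B + t ^ 2 * C) := by
      rw [hB, hC, mul_sum, mul_sum, ← sum_add_distrib, ← sum_add_distrib]
      refine sum_congr rfl fun v _ => ?_
      rw [excess_add_smul src tgt x (fun a => y a - x a) t v]
      ring
    linarith
  by_contra hneg
  push Not at hneg
  -- If the directional derivative `B` is negative, the step `t = -B / (C - B)` lies in `(0, 1]` and
  -- strictly decreases the objective.
  have hden : 0 < C - B := by linarith
  have h := key (-B / (C - B)) (div_nonneg (by linarith) hden.le)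
    ((div_le_one hden).2 (by linarith))
  have h1 : 2 * (-B / (C - B)) * B + (-B / (C - B)) ^ 2 * C
      = B ^ 2 * (2 * B - C) / (C - B) ^ 2 := by
    field_simp
    ring
  rw [h1] at h
  have h2 : B ^ 2 * (2 * B - C) / (C - B) ^ 2 < 0 :=
    div_neg_of_neg_of_pos (mul_neg_of_pos_of_neg (sq_pos_of_neg hneg) (by linarith)) (by positivity)
  linarith

/-- Hoffman's circulation theorem. -/
theorem exists_circulation (src tgt : A → N) (lo up : A → ℝ) (hle : ∀ a, lo a ≤ up a)
    (hcut : ∀ X : Finset N, ∑ a with src a ∉ X ∧ tgt a ∈ X, lo a ≤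
      ∑ a with src a ∈ X ∧ tgt a ∉ X, up a) :
    ∃ x : A → ℝ, (∀ a, lo a ≤ x a ∧ x a ≤ up a) ∧ ∀ v, excess src tgt x v = 0 := by
  classical
  obtain ⟨x, hx, hstat⟩ := exists_excess_stationary src tgt lo up hle
  set e := excess src tgt x with he
  refine ⟨x, fun a => ⟨hx.1 a, hx.2 a⟩, ?_⟩
  -- Box constraints decouple the arcs, so stationarity may be tested one coordinate at a time.
  have hupd : ∀ a c, lo a ≤ c → c ≤ up a → 0 ≤ (c - x a) * (e (tgt a) - e (src a)) := by
    intro a c h1 h2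
    have h := hstat (Function.update x a c) ⟨?_, ?_⟩
    · rw [sum_eq_single a] at h
      · simpa using h
      · intro b _ hb
        simp [hb]
      · simp
    · intro b
      by_cases hb : b = a
      · subst hb; simpa using h1
      · simpa [hb] using hx.1 b
    · intro b
      by_cases hb : b = a
      · subst hb; simpa using h2
      · simpa [hb] using hx.2 b
  have hsum0 : ∑ v, e v = 0 := by
    have := sum_mul_excess src tgt x (fun _ => 1)
    simpa using this
  -- The critical cut: optimality saturates the arcs leaving `X` and puts those entering at their
  -- lower bounds. The cut condition then makes the total excess on `X` nonpositive, so `X` is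
  -- empty.
  set X : Finset N := univ.filter fun v => 0 < e v with hX
  have hleave : ∀ a, src a ∈ X → tgt a ∉ X → x a = up a := by
    intro a h1 h2
    simp only [hX, mem_filter, mem_univ, true_and, not_lt] at h1 h2
    have := hupd a (up a) (hle a) le_rfl
    have := hx.2 a
    nlinarith
  have henter : ∀ a, src a ∉ X → tgt a ∈ X → x a = lo a := by
    intro a h1 h2
    simp only [hX, mem_filter, mem_univ, true_and, not_lt] at h1 h2
    have := hupd a (lo a) le_rfl (hle a)
    have := hx.1 a
    nlinarith
  have hXsum : ∑ v ∈ X, e v ≤ 0 := by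
    have h1 := sum_mul_excess src tgt x (fun v => if v ∈ X then 1 else 0)
    have h2 : ∑ v ∈ X, e v = ∑ v, (if v ∈ X then (1 : ℝ) else 0) * excess src tgt x v := by
      simp [he]
    have h3 : ∑ a, x a * ((if tgt a ∈ X then (1 : ℝ) else 0) - (if src a ∈ X then 1 else 0))
        = ∑ a with src a ∉ X ∧ tgt a ∈ X, lo a - ∑ a with src a ∈ X ∧ tgt a ∉ X, up a := by
      rw [sum_filter, sum_filter, ← sum_sub_distrib]
      refine sum_congr rfl fun a _ => ?_
      by_cases hs : src a ∈ X <;> by_cases ht : tgt a ∈ X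
      · simp [hs, ht]
      · simp [hs, ht, hleave a hs ht]
      · simp [hs, ht, henter a hs ht]
      · simp [hs, ht]
    rw [h2, h1, h3]
    linarith [hcut X]
  have hnonpos : ∀ v, e v ≤ 0 := by
    intro v
    by_contra hv
    push Not at hv
    have hvX : v ∈ X := by simp [hX, hv]
    have : 0 < ∑ v ∈ X, e v :=
      sum_pos (fun w hw => (mem_filter.1 hw).2) ⟨v, hvX⟩
    linarith
  intro v
  exact (sum_eq_zero_iff_of_nonpos fun w _ => hnonpos w).1 hsum0 v (mem_univ v)

end Circulation

/-! ### Counting arcs and capacities. -/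

section Counting

open Classical in
theorem arcCount_eq_sum {α β : Type*} [Fintype α] [Fintype β] (A : α → β → Prop) (X : Finset α)
    (Y : Finset β) :
    (arcCount A X Y : ℝ) = ∑ a, ∑ b, if a ∈ X ∧ b ∈ Y ∧ A a b then 1 else 0 := by
  rw [arcCount, card_filter, sum_product]
  push_cast
  rw [← sum_subset (subset_univ X)]
  · refine sum_congr rfl fun a ha => ?_
    rw [← sum_subset (subset_univ Y)]
    · exact sum_congr rfl fun b hb => by simp [ha, hb]
    · intro b _ hb
      simp [hb]
  · intro a _ ha
    simp [ha]

open Classical in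
theorem card_filter_le_arcCount {α β : Type*} (A : α → β → Prop) (X : Finset α) (Y : Finset β) :
    (X.filter fun a => ∃ b ∈ Y, A a b).card ≤ arcCount A X Y := by
  unfold arcCount
  refine (card_le_card ?_).trans
    (card_image_le (s := (X ×ˢ Y).filter fun p => A p.1 p.2) (f := Prod.fst))
  intro a ha
  obtain ⟨haX, b, hb, hab⟩ := mem_filter.1 ha
  exact mem_image.2 ⟨(a, b), by simp [haX, hb, hab], rfl⟩

theorem arcCount_pos {α β : Type*} {A : α → β → Prop} {X : Finset α} {Y : Finset β} {a : α} {b : β}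
    (ha : a ∈ X) (hb : b ∈ Y) (hab : A a b) : 1 ≤ arcCount A X Y := by
  classical
  exact card_pos.2 ⟨(a, b), by simp [ha, hb, hab]⟩

theorem arcCount_eq_zero {α β : Type*} {A : α → β → Prop} {X : Finset α} {Y : Finset β}
    (h : ∀ a ∈ X, ∀ b ∈ Y, ¬ A a b) : arcCount A X Y = 0 := by
  classical
  refine card_eq_zero.2 (filter_eq_empty_iff.2 fun p hp => ?_)
  rw [mem_product] at hp
  exact h _ hp.1 _ hp.2

-- Each node of `F` is the tail of exactly one arc of `A_3`, so arcs can be counted by their tails.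
open Classical in
theorem arcCount_arc₃ {l k₀ : ℕ} (X : Finset (FNode l k₀)) (Y : Finset (Fin k₀)) :
    arcCount Arc₃ X Y = (X.filter fun f => f.2 ∈ Y).card := by
  unfold arcCount Arc₃
  refine card_nbij' Prod.fst (fun f => (f, f.2)) ?_ ?_ ?_ ?_
  · rintro ⟨f, i⟩ h
    simp at h ⊢
    exact ⟨h.1.1, h.2 ▸ h.1.2⟩
  · intro f h
    simp at h ⊢
    exact h
  · rintro ⟨f, i⟩ h
    simp at h ⊢
    exact h.2
  · intro f h
    rfl

theorem mem_inNbrs {l k₀ : ℕ} {T : Finset (Fin k₀)} {f : FNode l k₀} :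
    f ∈ inNbrs T ↔ f.2 ∈ T := by
  simp [inNbrs, Arc₃]

theorem mem_cliqueNodes {l k₀ : ℕ} {f : FNode l k₀} : f ∈ cliqueNodes l k₀ ↔ f.1 ≠ 0 := by
  simp [cliqueNodes]

theorem mem_restNodes {l k₀ : ℕ} {f : FNode l k₀} : f ∈ restNodes l k₀ ↔ f.1 = 0 := by
  simp [restNodes]

/-- The capacity of the arc leaving a node of `F`, where `m` stands for `|U^0|`. -/
def fCap {l k₀ : ℕ} (m : ℕ) (f : FNode l k₀) : ℝ := if f.1 = 0 then m else 1

open Classical in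
theorem arcCount_capacity {l k₀ : ℕ} (m : ℕ) (Z : Finset (FNode l k₀)) (T : Finset (Fin k₀)) :
    (arcCount Arc₃ (Z ∩ cliqueNodes l k₀) T : ℝ) + m * (arcCount Arc₃ (Z ∩ restNodes l k₀) T : ℝ)
      = ∑ f, if f ∈ Z ∧ f.2 ∈ T then fCap m f else 0 := by
  rw [arcCount_arc₃, arcCount_arc₃, card_filter, card_filter]
  push_cast
  rw [← filter_mem_eq_inter, ← filter_mem_eq_inter, sum_filter, sum_filter, mul_sum,
    ← sum_add_distrib, ← sum_subset (subset_univ Z)]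
  · refine sum_congr rfl fun f hf => ?_
    by_cases h0 : f.1 = 0 <;> by_cases hT : f.2 ∈ T <;>
      simp [hf, h0, hT, fCap, mem_cliqueNodes, mem_restNodes]
  · intro f _ hf
    simp [hf]

end Counting

/-! ### Reduction of the Hall conditions to the three families. -/

section Network

variable {V : Type*} [Fintype V] {G : SimpleGraph V} {k l k₀ : ℕ} {P : PartialColoring G k}

theorem Decomposition.part_subset (D : Decomposition P l) (j : Fin (l + 1)) :
    D.part j ⊆ P.uncolored := fun v hv => (D.mem_uncolored_iff v).2 ⟨j, hv⟩

theorem Decomposition.part_unique (D : Decomposition P l) {i j : Fin (l + 1)} {v : V}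
    (hi : v ∈ D.part i) (hj : v ∈ D.part j) : i = j := by
  by_contra h
  exact disjoint_left.1 (D.disjoint i j h) hi hj

variable (D : Decomposition P l) (hk₀ : k₀ ≤ Fintype.card V)

theorem mem_outNbrs {v : V} {f : FNode l k₀} : f ∈ outNbrs D hk₀ v ↔ Arc₂ D hk₀ v f := by
  simp [outNbrs]

theorem mem_posR {S : Finset (FNode l k₀)} {v : V} :
    v ∈ posR D hk₀ S ↔ v ∈ P.uncolored ∧ ∃ f ∈ S, Arc₂ D hk₀ v f := by
  classical
  simp only [posR, mem_filter, Finset.Nonempty, mem_inter, mem_outNbrs]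
  refine and_congr_right fun _ => exists_congr fun f => and_comm

theorem mem_negR {S : Finset (FNode l k₀)} {v : V} :
    v ∈ negR D hk₀ S ↔ v ∈ P.uncolored ∧ ∀ f, Arc₂ D hk₀ v f → f ∈ S := by
  simp [negR, subset_iff, mem_outNbrs]

-- A vertex of `posR` outside `R` has an arc into `S` counted in the last term; hence `posR` is the
-- optimal choice of `R`.
open Classical in
theorem card_posR_le (R : Finset V) (S : Finset (FNode l k₀)) :
    (posR D hk₀ S).card ≤ R.card + arcCount (Arc₂ D hk₀) (P.uncolored \ R) S := by
  have hsub : posR D hk₀ S ⊆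
      R ∪ (P.uncolored \ R).filter fun v => ∃ f ∈ S, Arc₂ D hk₀ v f := by
    intro v hv
    rw [mem_posR] at hv
    by_cases hR : v ∈ R <;> simp [hR, hv.1]
    simpa using hv.2
  have h1 := card_le_card hsub
  have h2 := card_union_le R ((P.uncolored \ R).filter fun v => ∃ f ∈ S, Arc₂ D hk₀ v f)
  have h3 := card_filter_le_arcCount (Arc₂ D hk₀) (P.uncolored \ R) S
  omega

-- The negative counterpart: a vertex of `R` outside `negR` has an arc leaving `S`.
open Classical in
theorem card_le_card_negR {R : Finset V} (hR : R ⊆ P.uncolored) (S : Finset (FNode l k₀)) :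
    R.card ≤ (negR D hk₀ S).card + arcCount (Arc₂ D hk₀) R Sᶜ := by
  have hsub : R ⊆ negR D hk₀ S ∪ R.filter fun v => ∃ f ∈ Sᶜ, Arc₂ D hk₀ v f := by
    intro v hv
    rw [mem_union, mem_filter, mem_negR]
    by_cases h : ∀ f, Arc₂ D hk₀ v f → f ∈ S
    · exact Or.inl ⟨hR hv, h⟩
    · push Not at h
      obtain ⟨f, hf, hfS⟩ := h
      exact Or.inr ⟨hv, f, by simpa using hfS, hf⟩
  have h1 := card_le_card hsub
  have h2 := card_union_le (negR D hk₀ S) (R.filter fun v => ∃ f ∈ Sᶜ, Arc₂ D hk₀ v f)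
  have h3 := card_filter_le_arcCount (Arc₂ D hk₀) R Sᶜ
  omega

theorem posHallRhs_of_posChoice {S : Finset (FNode l k₀)} {T : Finset (Fin k₀)}
    (h : PosChoice S T) :
    posHallRhs D hk₀ (posR D hk₀ S) S T = ((posR D hk₀ S).card : ℤ)
      + (arcCount Arc₃ (cliqueNodes l k₀ \ S) T : ℤ) - ∑ i ∈ T, lowerNeed P hk₀ i := by
  classical
  have h1 : arcCount (Arc₂ D hk₀) (P.uncolored \ posR D hk₀ S) S = 0 := by
    refine arcCount_eq_zero fun v hv f hf hvf => ?_
    rw [mem_sdiff, mem_posR] at hv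
    exact hv.2 ⟨hv.1, f, hf, hvf⟩
  have h2 : arcCount Arc₃ (restNodes l k₀ \ S) T = 0 := by
    refine arcCount_eq_zero fun f hf i hi hfi => ?_
    rw [mem_sdiff] at hf
    have : f ∈ S ∩ restNodes l k₀ := by
      rw [h.2.2, mem_inter, mem_inNbrs]
      exact ⟨(show f.2 = i from hfi) ▸ hi, hf.1⟩
    exact hf.2 (mem_inter.1 this).1
  rw [posHallRhs, h1, h2, sum_neg_distrib]
  push_cast
  ring

theorem posHall_iff_posCondition {S : Finset (FNode l k₀)} {T : Finset (Fin k₀)}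
    (h : PosChoice S T) :
    0 ≤ posHallRhs D hk₀ (posR D hk₀ S) S T ↔ PosCondition D hk₀ S T := by
  rw [posHallRhs_of_posChoice D hk₀ h, PosCondition]
  exact sub_nonneg

theorem exists_posChoice_le (R : Finset V) (S : Finset (FNode l k₀)) {T : Finset (Fin k₀)}
    (hT : T.Nonempty) :
    ∃ S' : Finset (FNode l k₀), PosChoice S' T ∧
      posHallRhs D hk₀ (posR D hk₀ S') S' T ≤ posHallRhs D hk₀ R S T := by
  classical
  -- Nodes not over `T` are discarded and all nodes of `F^0` over `T` are added.
  set S' : Finset (FNode l k₀) := univ.filter fun f => f.2 ∈ T ∧ (f.1 = 0 ∨ f ∈ S) with hS'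
  have hmem : ∀ f, f ∈ S' ↔ f.2 ∈ T ∧ (f.1 = 0 ∨ f ∈ S) := fun f => by
    rw [hS', mem_filter]; simp
  have hch : PosChoice S' T := by
    refine ⟨hT, fun f hf => mem_inNbrs.2 ((hmem f).1 hf).1, ?_⟩
    ext f
    simp only [mem_inter, hmem, mem_inNbrs, mem_restNodes]
    tauto
  refine ⟨S', hch, ?_⟩
  have hclique : arcCount Arc₃ (cliqueNodes l k₀ \ S') T = arcCount Arc₃ (cliqueNodes l k₀ \ S) T := by
    rw [arcCount_arc₃, arcCount_arc₃]
    congr 1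
    ext f
    simp only [mem_filter, mem_sdiff, hmem, mem_cliqueNodes]
    tauto
  -- Vertices gained by enlarging `S` on `F^0` lie in `U^0`. If some node was really added, the term
  -- with factor `|U^0|` pays for all of them at once.
  have hposR : (posR D hk₀ S').card ≤ (posR D hk₀ S).card
      + (D.part 0).card * arcCount Arc₃ (restNodes l k₀ \ S) T := by
    by_cases hex : ∃ f : FNode l k₀, f.2 ∈ T ∧ f.1 = 0 ∧ f ∉ S
    · obtain ⟨f, hfT, hf0, hfS⟩ := hex
      have h1 : 1 ≤ arcCount Arc₃ (restNodes l k₀ \ S) T :=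
        arcCount_pos (mem_sdiff.2 ⟨mem_restNodes.2 hf0, hfS⟩) hfT rfl
      have hsub : posR D hk₀ S' ⊆ posR D hk₀ S ∪ D.part 0 := by
        intro v hv
        obtain ⟨hvU, g, hg, hvg⟩ := (mem_posR D hk₀).1 hv
        rw [mem_union, mem_posR]
        rcases ((hmem g).1 hg).2 with h0 | hS
        · exact Or.inr (h0 ▸ hvg.1)
        · exact Or.inl ⟨hvU, g, hS, hvg⟩
      have h2 := (card_le_card hsub).trans (card_union_le _ _)
      nlinarith
    · push Not at hex
      have hsub : posR D hk₀ S' ⊆ posR D hk₀ S := by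
        intro v hv
        obtain ⟨hvU, g, hg, hvg⟩ := (mem_posR D hk₀).1 hv
        obtain ⟨hgT, hg⟩ := (hmem g).1 hg
        exact (mem_posR D hk₀).2 ⟨hvU, g, hg.elim (hex g hgT) id, hvg⟩
      exact (card_le_card hsub).trans (Nat.le_add_right _ _)
  have hcard := card_posR_le D hk₀ R S
  rw [posHallRhs_of_posChoice D hk₀ hch, posHallRhs, hclique, sum_neg_distrib]
  have h := hposR.trans (Nat.add_le_add_right hcard _)
  zify at h
  linarith

theorem posHall_iff_familyPos :
    (∀ (R : Finset V) (S : Finset (FNode l k₀)) (T : Finset (Fin k₀)),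
      R ⊆ P.uncolored → 0 ≤ posHallRhs D hk₀ R S T) ↔ FamilyPos D hk₀ := by
  classical
  constructor
  · intro h S T hST
    exact (posHall_iff_posCondition D hk₀ hST).1
      (h _ _ _ fun v hv => ((mem_posR D hk₀).1 hv).1)
  · intro h R S T _
    rcases T.eq_empty_or_nonempty with rfl | hT
    · rw [posHallRhs, sum_empty]
      positivity
    · obtain ⟨S', hS', hle⟩ := exists_posChoice_le D hk₀ R S hT
      exact ((posHall_iff_posCondition D hk₀ hS').2 (h S' T hS')).trans hle

-- A vertex of `U^j` has all its arcs into `F^j`, so the condition splits over the cliques.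
open Classical in
theorem card_negR_le_of_subset_cliqueNodes (hC : FamilyClique D hk₀) {S : Finset (FNode l k₀)}
    (hS : S ⊆ cliqueNodes l k₀) : (negR D hk₀ S).card ≤ S.card := by
  -- The case `S = ∅` says that every uncolored vertex has an arc. This excludes vertices of `U^0`,
  -- whose arcs cannot end in `F^C`.
  have hempty : negR D hk₀ (∅ : Finset (FNode l k₀)) = ∅ := by
    have := hC ∅ (Or.inl rfl)
    simpa using this
  have hsub : negR D hk₀ S ⊆
      (univ.filter fun j : Fin (l + 1) => j ≠ 0).biUnion
        fun j => negR D hk₀ (S.filter fun f => f.1 = j) := by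
    intro v hv
    rw [mem_negR] at hv
    obtain ⟨j, hj⟩ := (D.mem_uncolored_iff v).1 hv.1
    have hj0 : j ≠ 0 := by
      rintro rfl
      have : v ∈ negR D hk₀ (∅ : Finset (FNode l k₀)) := by
        refine (mem_negR D hk₀).2 ⟨hv.1, fun f hf => ?_⟩
        exact absurd (D.part_unique hf.1 hj) (mem_cliqueNodes.1 (hS (hv.2 f hf)))
      simp [hempty] at this
    refine mem_biUnion.2 ⟨j, by simpa using hj0, (mem_negR D hk₀).2 ⟨hv.1, fun f hf => ?_⟩⟩
    exact mem_filter.2 ⟨hv.2 f hf, D.part_unique hf.1 hj⟩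
  calc (negR D hk₀ S).card
      ≤ ∑ j : Fin (l + 1) with j ≠ 0, (negR D hk₀ (S.filter fun f => f.1 = j)).card :=
        (card_le_card hsub).trans card_biUnion_le
    _ ≤ ∑ j : Fin (l + 1) with j ≠ 0, (S.filter fun f => f.1 = j).card := by
        refine sum_le_sum fun j hj => hC _ (Or.inr ⟨j, (mem_filter.1 hj).2, fun f hf => ?_⟩)
        exact (mem_filter.1 hf).2
    _ = S.card := by
        refine (card_eq_sum_card_fiberwise fun f hf => ?_).symm
        simpa using mem_cliqueNodes.1 (hS hf)

open Classical in
/-- The negative Hall conditions follow from the second and the third family. -/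
theorem negHall_of_families (hC : FamilyClique D hk₀) (hN : FamilyNeg D hk₀) {R : Finset V}
    (hR : R ⊆ P.uncolored) (S : Finset (FNode l k₀)) (T : Finset (Fin k₀)) :
    (R.card : ℤ) ≤ (arcCount (Arc₂ D hk₀) R Sᶜ : ℤ)
      + ((arcCount Arc₃ (S ∩ cliqueNodes l k₀) Tᶜ : ℤ)
        + ((D.part 0).card : ℤ) * (arcCount Arc₃ (S ∩ restNodes l k₀) Tᶜ : ℤ))
      + ∑ i ∈ T, upperNeed P hk₀ i := by
  set S' : Finset (FNode l k₀) := univ.filter fun f => f.2 ∈ T ∨ (f.1 ≠ 0 ∧ f ∈ S) with hS'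
  have hmem : ∀ f, f ∈ S' ↔ f.2 ∈ T ∨ (f.1 ≠ 0 ∧ f ∈ S) := fun f => by
    rw [hS', mem_filter]; simp
  have hred : ((negR D hk₀ S').card : ℤ) ≤
      (arcCount Arc₃ (S' ∩ cliqueNodes l k₀) Tᶜ : ℤ) + ∑ i ∈ T, upperNeed P hk₀ i := by
    -- For `T = ∅` the normalized set lies in `F^C` and the second family applies; otherwise the
    -- third does.
    rcases T.eq_empty_or_nonempty with rfl | hT
    · have hsub : S' ⊆ cliqueNodes l k₀ := by
        intro f hf
        rw [hmem] at hf
        exact mem_cliqueNodes.2 (by simpa using hf.elim (by simp) And.left)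
      have h := card_negR_le_of_subset_cliqueNodes D hk₀ hC hsub
      rw [inter_eq_left.2 hsub, arcCount_arc₃]
      simpa using h
    · have h := hN S' T hT (fun f hf => (hmem f).2 (Or.inl (mem_inNbrs.1 hf))) (by
        ext f
        simp only [mem_inter, hmem, mem_inNbrs, mem_restNodes]
        tauto)
      rw [sum_neg_distrib, ← compl_eq_univ_sdiff] at h
      linarith
  have hclique : arcCount Arc₃ (S' ∩ cliqueNodes l k₀) Tᶜ =
      arcCount Arc₃ (S ∩ cliqueNodes l k₀) Tᶜ := by
    rw [arcCount_arc₃, arcCount_arc₃]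
    congr 1
    ext f
    simp only [mem_filter, mem_inter, hmem, mem_cliqueNodes, mem_compl]
    tauto
  -- Only vertices of `U^0` can drop out of `negR`, and one node of `F^0` removed from `S` pays for
  -- them all.
  have hnegR : (negR D hk₀ S).card ≤ (negR D hk₀ S').card
      + (D.part 0).card * arcCount Arc₃ (S ∩ restNodes l k₀) Tᶜ := by
    by_cases hex : ∃ f ∈ S, f.2 ∉ T ∧ f.1 = 0
    · obtain ⟨f, hfS, hfT, hf0⟩ := hex
      have h1 : 1 ≤ arcCount Arc₃ (S ∩ restNodes l k₀) Tᶜ :=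
        arcCount_pos (mem_inter.2 ⟨hfS, mem_restNodes.2 hf0⟩) (mem_compl.2 hfT) rfl
      have hsub : negR D hk₀ S ⊆ negR D hk₀ S' ∪ D.part 0 := by
        intro v hv
        rw [mem_negR] at hv
        rw [mem_union, mem_negR, or_iff_not_imp_right]
        refine fun hv0 => ⟨hv.1, fun g hg => (hmem g).2 (Or.inr ⟨fun h0 => ?_, hv.2 g hg⟩)⟩
        exact hv0 (h0 ▸ hg.1)
      have h2 := (card_le_card hsub).trans (card_union_le _ _)
      nlinarith
    · push Not at hex
      have hsub : negR D hk₀ S ⊆ negR D hk₀ S' := by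
        intro v hv
        rw [mem_negR] at hv ⊢
        refine ⟨hv.1, fun g hg => (hmem g).2 ?_⟩
        by_cases hgT : g.2 ∈ T
        · exact Or.inl hgT
        · exact Or.inr ⟨hex g (hv.2 g hg) hgT, hv.2 g hg⟩
      exact (card_le_card hsub).trans (Nat.le_add_right _ _)
  have hcard := card_le_card_negR D hk₀ hR S
  rw [hclique] at hred
  zify at hnegR hcard
  linarith

end Network

/-! ### Flows described by their values on `A_2`. -/

section Routing

variable {V : Type*} [Fintype V] {G : SimpleGraph V} {k l k₀ : ℕ} {P : PartialColoring G k}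

/-- A feasible flow, given by its values `x` on `A_2` extended by zero; the flow on `A_3` is given by
the column sums of `x`. -/
structure IsRouting (D : Decomposition P l) (hk₀ : k₀ ≤ Fintype.card V)
    (x : V → FNode l k₀ → ℝ) : Prop where
  nonneg : ∀ u f, 0 ≤ x u f
  support : ∀ u f, ¬ (u ∈ P.uncolored ∧ Arc₂ D hk₀ u f) → x u f = 0
  row : ∀ u ∈ P.uncolored, ∑ f, x u f = 1
  col : ∀ f : FNode l k₀, f.1 ≠ 0 → ∑ u, x u f ≤ 1
  lower : ∀ i, (lowerNeed P hk₀ i : ℝ) ≤ ∑ f : FNode l k₀ with f.2 = i, ∑ u, x u f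
  upper : ∀ i, ∑ f : FNode l k₀ with f.2 = i, ∑ u, x u f ≤ (upperNeed P hk₀ i : ℝ)

variable (D : Decomposition P l) (hk₀ : k₀ ≤ Fintype.card V)

variable {D hk₀} in
theorem IsRouting.le_one {x : V → FNode l k₀ → ℝ} (hx : IsRouting D hk₀ x) {u : V}
    (hu : u ∈ P.uncolored) (f : FNode l k₀) : x u f ≤ 1 := by
  rw [← hx.row u hu]
  exact single_le_sum (fun g _ => hx.nonneg u g) (mem_univ f)

/-- Conservation determines `y`. The capacity `|U^0|` is automatic, since a node of `F^0` receives
at most one unit from each vertex of `U^0`. -/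
theorem feasible_iff_exists_isRouting : Feasible D hk₀ ↔ ∃ x, IsRouting D hk₀ x := by
  classical
  constructor
  · rintro ⟨x, y, hrow, hcol, hneed, hx, hyC, -⟩
    have hcol' : ∀ f : FNode l k₀,
        ∑ u, (if u ∈ P.uncolored ∧ Arc₂ D hk₀ u f then x u f else 0) = y f f.2 := by
      intro f
      have h := hcol f f.2 rfl
      rw [sub_eq_zero] at h
      rw [h, ← sum_filter]
      refine sum_congr ?_ fun _ _ => rfl
      ext u
      simp
    have hneed' : ∀ i, ∑ f : FNode l k₀ with f.2 = i, y f f.2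
        = ∑ f : FNode l k₀ with Arc₃ f i, y f i := by
      intro i
      refine sum_congr (filter_congr fun _ _ => Iff.rfl) fun f hf => ?_
      rw [(mem_filter.1 hf).2]
    refine ⟨fun u f => if u ∈ P.uncolored ∧ Arc₂ D hk₀ u f then x u f else 0,
      ⟨?_, ?_, ?_, ?_, ?_, ?_⟩⟩
    · intro u f
      split_ifs with h
      exacts [(hx u h.1 f h.2).1, le_rfl]
    · intro u f h
      simp only [if_neg h]
    · intro u hu
      rw [← hrow u hu, sum_filter]
      simp [hu]
    · intro f hf
      rw [hcol']
      exact (hyC f (mem_cliqueNodes.2 hf) f.2 rfl).2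
    · intro i
      simp only [hcol', hneed']
      exact (hneed i).1
    · intro i
      simp only [hcol', hneed']
      exact (hneed i).2
  · rintro ⟨x, hx⟩
    refine ⟨x, fun f _ => ∑ u, x u f, ?_, ?_, ?_, ?_, ?_, ?_⟩
    · intro u hu
      rw [← hx.row u hu, sum_filter]
      refine sum_congr rfl fun f _ => ?_
      split_ifs with h
      · rfl
      · exact (hx.support u f fun h' => h h'.2).symm
    · intro f i _
      rw [sub_eq_zero]
      refine (sum_subset (subset_univ _) fun u _ hu => hx.support u f fun h => hu ?_).symm
      simpa using h
    · intro i
      have h : ∑ f : FNode l k₀ with Arc₃ f i, ∑ u, x u f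
          = ∑ f : FNode l k₀ with f.2 = i, ∑ u, x u f :=
        sum_congr (filter_congr fun _ _ => Iff.rfl) fun _ _ => rfl
      rw [h]
      exact ⟨hx.lower i, hx.upper i⟩
    · exact fun u hu f _ => ⟨hx.nonneg u f, hx.le_one hu f⟩
    · exact fun f hf i _ => ⟨sum_nonneg fun u _ => hx.nonneg u f, hx.col f (mem_cliqueNodes.1 hf)⟩
    · refine fun f hf i _ => ⟨sum_nonneg fun u _ => hx.nonneg u f, ?_⟩
      change ∑ u, x u f ≤ _
      rw [← sum_subset (subset_univ (D.part 0))]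
      · have h := sum_le_card_nsmul (D.part 0) (fun u => x u f) 1
          fun u hu => hx.le_one (D.part_subset 0 hu) f
        simpa using h
      · intro u _ hu
        exact hx.support u f fun h => hu (mem_restNodes.1 hf ▸ h.2.1)

/-! ### Every flow satisfies the three families. -/

section Necessity

variable {D hk₀} {x : V → FNode l k₀ → ℝ}

-- The whole unit sent out by each vertex of `negR` ends in `S`.
open Classical in
theorem IsRouting.card_negR_le (hx : IsRouting D hk₀ x) (S : Finset (FNode l k₀)) :
    ((negR D hk₀ S).card : ℝ) ≤ ∑ f ∈ S, ∑ u, x u f := by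
  rw [sum_comm, card_eq_sum_ones]
  push_cast
  calc ∑ u ∈ negR D hk₀ S, (1 : ℝ) ≤ ∑ u ∈ negR D hk₀ S, ∑ f ∈ S, x u f := by
        refine sum_le_sum fun u hu => ?_
        rw [mem_negR] at hu
        rw [← hx.row u hu.1]
        exact (sum_subset (subset_univ S) fun f _ hf =>
          hx.support u f fun h => hf (hu.2 f h.2)).ge
    _ ≤ ∑ u, ∑ f ∈ S, x u f :=
        sum_le_sum_of_subset_of_nonneg (subset_univ _) fun u _ _ =>
          sum_nonneg fun f _ => hx.nonneg u f

open Classical in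
theorem IsRouting.le_card_posR (hx : IsRouting D hk₀ x) (S : Finset (FNode l k₀)) :
    ∑ f ∈ S, ∑ u, x u f ≤ ((posR D hk₀ S).card : ℝ) := by
  rw [sum_comm, card_eq_sum_ones]
  push_cast
  calc ∑ u, ∑ f ∈ S, x u f = ∑ u ∈ posR D hk₀ S, ∑ f ∈ S, x u f := by
        refine (sum_subset (subset_univ _) fun u _ hu => sum_eq_zero fun f hf => ?_).symm
        exact hx.support u f fun h => hu ((mem_posR D hk₀).2 ⟨h.1, f, hf, h.2⟩)
    _ ≤ ∑ u ∈ posR D hk₀ S, (1 : ℝ) := by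
        refine sum_le_sum fun u hu => ?_
        rw [← hx.row u ((mem_posR D hk₀).1 hu).1]
        exact sum_le_sum_of_subset_of_nonneg (subset_univ _) fun f _ _ => hx.nonneg u f

theorem sum_colors_eq (T : Finset (Fin k₀)) (y : FNode l k₀ → ℝ) :
    ∑ i ∈ T, ∑ f : FNode l k₀ with f.2 = i, y f = ∑ f ∈ inNbrs T, y f := by
  classical
  rw [← sum_fiberwise_of_maps_to (s := inNbrs T) (t := T) (g := Prod.snd)
    fun f hf => mem_inNbrs.1 hf]
  refine sum_congr rfl fun i hi => sum_congr ?_ fun _ _ => rfl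
  ext f
  simp only [mem_filter, mem_univ, true_and, mem_inNbrs]
  exact ⟨fun h => ⟨h ▸ hi, h⟩, And.right⟩

theorem IsRouting.sum_le_card (hx : IsRouting D hk₀ x) {S : Finset (FNode l k₀)}
    (hS : ∀ f ∈ S, f.1 ≠ 0) : ∑ f ∈ S, ∑ u, x u f ≤ (S.card : ℝ) := by
  have h := sum_le_card_nsmul S (fun f => ∑ u, x u f) 1 fun f hf => hx.col f (hS f hf)
  simpa using h

/-- The flow into `T` passes through `S`, carrying at most `|R_+|`, or through `δ⁻(T) \ S`. The
latter lies in `F^C`, where each node carries at most one unit. -/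
theorem IsRouting.familyPos (hx : IsRouting D hk₀ x) : FamilyPos D hk₀ := by
  classical
  intro S T hST
  have h1 : ((∑ i ∈ T, lowerNeed P hk₀ i : ℤ) : ℝ) ≤ ∑ f ∈ inNbrs T, ∑ u, x u f := by
    rw [← sum_colors_eq]
    push_cast
    exact sum_le_sum fun i _ => hx.lower i
  rw [← sum_sdiff hST.2.1] at h1
  have h2 := hx.sum_le_card (S := inNbrs T \ S) fun f hf h0 => by
    rw [mem_sdiff] at hf
    have : f ∈ S ∩ restNodes l k₀ := by
      rw [hST.2.2]
      exact mem_inter.2 ⟨hf.1, mem_restNodes.2 h0⟩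
    exact hf.2 (mem_inter.1 this).1
  have h3 : inNbrs T \ S ⊆ (cliqueNodes l k₀ \ S).filter fun f => f.2 ∈ T := by
    intro f hf
    rw [mem_sdiff] at hf
    refine mem_filter.2 ⟨mem_sdiff.2 ⟨mem_cliqueNodes.2 fun h0 => ?_, hf.2⟩, mem_inNbrs.1 hf.1⟩
    have : f ∈ S ∩ restNodes l k₀ := by
      rw [hST.2.2]
      exact mem_inter.2 ⟨hf.1, mem_restNodes.2 h0⟩
    exact hf.2 (mem_inter.1 this).1
  have h4 := hx.le_card_posR S
  have h5 : ((inNbrs T \ S).card : ℝ) ≤ (arcCount Arc₃ (cliqueNodes l k₀ \ S) T : ℝ) := by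
    rw [arcCount_arc₃]
    exact_mod_cast card_le_card h3
  have h6 : ((∑ i ∈ T, lowerNeed P hk₀ i : ℤ) : ℝ) ≤ (((posR D hk₀ S).card : ℤ)
      + (arcCount Arc₃ (cliqueNodes l k₀ \ S) T : ℤ) : ℤ) := by
    push_cast at h1 ⊢
    linarith
  exact_mod_cast h6

theorem IsRouting.familyClique (hx : IsRouting D hk₀ x) : FamilyClique D hk₀ := by
  intro S hS
  have h := (hx.card_negR_le S).trans (hx.sum_le_card (S := S) fun f hf => ?_)
  · exact_mod_cast h
  · rcases hS with rfl | ⟨j, hj, hS⟩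
    · simp at hf
    · exact hS f hf ▸ hj

/-- The units of `R_-` stay within `S`: those in `δ⁻(T)` are bounded by the upper needs, and the
other nodes of `S` lie in `F^C` and carry at most one unit each. -/
theorem IsRouting.familyNeg (hx : IsRouting D hk₀ x) : FamilyNeg D hk₀ := by
  classical
  intro S T _ hTS hS0
  have h1 := hx.card_negR_le S
  rw [← sum_sdiff hTS] at h1
  have h2 : ∑ f ∈ inNbrs T, ∑ u, x u f ≤ ((∑ i ∈ T, upperNeed P hk₀ i : ℤ) : ℝ) := by
    rw [← sum_colors_eq]
    push_cast
    exact sum_le_sum fun i _ => hx.upper i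
  have h0 : ∀ f ∈ S \ inNbrs T, f.1 ≠ 0 := by
    intro f hf h0
    rw [mem_sdiff] at hf
    have : f ∈ inNbrs T ∩ restNodes l k₀ := by
      rw [← hS0]
      exact mem_inter.2 ⟨hf.1, mem_restNodes.2 h0⟩
    exact hf.2 (mem_inter.1 this).1
  have h3 := hx.sum_le_card h0
  have h4 : S \ inNbrs T ⊆ (S ∩ cliqueNodes l k₀).filter fun f => f.2 ∈ univ \ T := by
    intro f hf
    have hf' := mem_sdiff.1 hf
    rw [mem_inNbrs] at hf'
    simp only [mem_filter, mem_inter, mem_sdiff, mem_univ, true_and]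
    exact ⟨⟨hf'.1, mem_cliqueNodes.2 (h0 f hf)⟩, hf'.2⟩
  have h5 : ((S \ inNbrs T).card : ℝ) ≤
      (arcCount Arc₃ (S ∩ cliqueNodes l k₀) (univ \ T) : ℝ) := by
    rw [arcCount_arc₃]
    exact_mod_cast card_le_card h4
  have h6 : (((negR D hk₀ S).card : ℤ) : ℝ) ≤
      ((arcCount Arc₃ (S ∩ cliqueNodes l k₀) (univ \ T) : ℤ) + ∑ i ∈ T, upperNeed P hk₀ i : ℤ) := by
    push_cast at h2 ⊢
    linarith
  have h7 := Int.cast_le.1 h6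
  rw [sum_neg_distrib]
  linarith

end Necessity

/-! ### The three families give a circulation. -/

section Sufficiency

/-- The nodes of the network, `none` being an additional root. -/
abbrev Node (V : Type*) (l k₀ : ℕ) : Type _ := Option (V ⊕ FNode l k₀ ⊕ Fin k₀)

/-- The arcs of the circulation network: pairs for `A_2`, arcs of `A_3` given by their tails, arcs
from the colors to the root and arcs from the root to the vertices. -/
abbrev Arc (V : Type*) (l k₀ : ℕ) : Type _ := (V × FNode l k₀) ⊕ FNode l k₀ ⊕ Fin k₀ ⊕ V

/-- The tail of an arc. -/
def arcSrc : Arc V l k₀ → Node V l k₀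
  | .inl p => some (.inl p.1)
  | .inr (.inl f) => some (.inr (.inl f))
  | .inr (.inr (.inl i)) => some (.inr (.inr i))
  | .inr (.inr (.inr _)) => none

/-- The head of an arc. -/
def arcTgt : Arc V l k₀ → Node V l k₀
  | .inl p => some (.inr (.inl p.2))
  | .inr (.inl f) => some (.inr (.inr f.2))
  | .inr (.inr (.inl _)) => none
  | .inr (.inr (.inr u)) => some (.inl u)

open Classical in
/-- The lower bound on an arc. -/
noncomputable def arcLo (P : PartialColoring G k) (hk₀ : k₀ ≤ Fintype.card V) : Arc V l k₀ → ℝ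
  | .inl _ => 0
  | .inr (.inl _) => 0
  | .inr (.inr (.inl i)) => lowerNeed P hk₀ i
  | .inr (.inr (.inr u)) => if u ∈ P.uncolored then 1 else 0

open Classical in
/-- The upper bound on an arc. -/
noncomputable def arcUp (D : Decomposition P l) (hk₀ : k₀ ≤ Fintype.card V) : Arc V l k₀ → ℝ
  | .inl p => if p.1 ∈ P.uncolored ∧ Arc₂ D hk₀ p.1 p.2 then 1 else 0
  | .inr (.inl f) => fCap (D.part 0).card f
  | .inr (.inr (.inl i)) => upperNeed P hk₀ i
  | .inr (.inr (.inr u)) => if u ∈ P.uncolored then 1 else 0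

theorem sum_arc (g : Arc V l k₀ → ℝ) :
    ∑ a, g a = ∑ u, ∑ f, g (.inl (u, f)) + (∑ f, g (.inr (.inl f))
      + (∑ i, g (.inr (.inr (.inl i))) + ∑ u, g (.inr (.inr (.inr u))))) := by
  rw [Fintype.sum_sum_type, Fintype.sum_sum_type, Fintype.sum_sum_type,
    Fintype.sum_prod_type (fun p => g (.inl p))]

theorem arcLo_le_arcUp (a : Arc V l k₀) : arcLo P hk₀ a ≤ arcUp D hk₀ a := by
  rcases a with p | f | i | u
  · simp only [arcLo, arcUp]
    split_ifs <;> norm_num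
  · simp only [arcLo, arcUp, fCap]
    split_ifs <;> positivity
  · simp only [arcLo, arcUp, lowerNeed, upperNeed]
    exact Int.cast_le.2 (Int.sub_le_sub_right (Int.floor_le_ceil _) _)
  · exact le_rfl

open Classical in
theorem cut_of_families (hP : FamilyPos D hk₀) (hC : FamilyClique D hk₀) (hN : FamilyNeg D hk₀)
    (X : Finset (Node V l k₀)) :
    ∑ a with arcSrc a ∉ X ∧ arcTgt a ∈ X, arcLo P hk₀ a ≤
      ∑ a with arcSrc a ∈ X ∧ arcTgt a ∉ X, arcUp D hk₀ a := by
  set S : Finset (FNode l k₀) := univ.filter fun f => some (.inr (.inl f)) ∈ X with hS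
  set T : Finset (Fin k₀) := univ.filter fun i => some (.inr (.inr i)) ∈ X with hT
  have hSm : ∀ f, some (.inr (.inl f)) ∈ X ↔ f ∈ S := by simp [hS]
  have hTm : ∀ i, some (.inr (.inr i)) ∈ X ↔ i ∈ T := by simp [hT]
  have hcap := arcCount_capacity (D.part 0).card S Tᶜ
  rw [sum_filter, sum_filter, sum_arc, sum_arc]
  simp only [arcSrc, arcTgt, arcLo, arcUp]
  -- With the root in `X`, the cut inequality is the positive Hall condition for the parts of `U`,
  -- `F`, `C` outside `X`.
  by_cases hr : (none : Node V l k₀) ∈ X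
  · set R : Finset V := univ.filter fun u => u ∈ P.uncolored ∧ some (.inl u) ∉ X with hR
    have h := (posHall_iff_familyPos D hk₀).2 hP R Sᶜ Tᶜ
      fun u hu => (mem_filter.1 hu).2.1
    have hsd : ∀ Z : Finset (FNode l k₀), Z \ Sᶜ = S ∩ Z := fun Z => by
      ext; simp [and_comm]
    rw [posHallRhs, hsd, hsd, sum_neg_distrib] at h
    have h' : (((∑ i ∈ Tᶜ, lowerNeed P hk₀ i : ℤ)) : ℝ) ≤ (R.card : ℝ)
        + (arcCount (Arc₂ D hk₀) (P.uncolored \ R) Sᶜ : ℝ)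
        + ∑ f, if f ∈ S ∧ f.2 ∈ Tᶜ then fCap (D.part 0).card f else 0 := by
      rw [← hcap]
      have := (Int.cast_le (R := ℝ)).2 h
      push_cast at this ⊢
      linarith
    have hlow : ((∑ i ∈ Tᶜ, lowerNeed P hk₀ i : ℤ) : ℝ)
        = ∑ i, if i ∈ T then 0 else (lowerNeed P hk₀ i : ℝ) := by
      push_cast
      rw [← sum_subset (subset_univ Tᶜ) (by intro i _ hi; simp_all)]
      exact sum_congr rfl fun i hi => by rw [if_neg (mem_compl.1 hi)]
    have hcard : (R.card : ℝ)
        = ∑ u, if some (.inl u) ∈ X then 0 else if u ∈ P.uncolored then 1 else 0 := by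
      rw [hR, card_filter]
      push_cast
      refine sum_congr rfl fun u _ => ?_
      by_cases h1 : some (.inl u) ∈ X <;> simp [h1]
    have harc : (arcCount (Arc₂ D hk₀) (P.uncolored \ R) Sᶜ : ℝ) = ∑ u, ∑ f,
        if some (.inl u) ∈ X ∧ f ∉ S then
          if u ∈ P.uncolored ∧ Arc₂ D hk₀ u f then (1 : ℝ) else 0 else 0 := by
      rw [arcCount_eq_sum]
      refine sum_congr rfl fun u _ => sum_congr rfl fun f _ => ?_
      rw [← ite_and]
      simp only [hR, mem_sdiff, mem_filter, mem_univ, true_and, mem_compl]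
      congr 1
      apply propext
      tauto
    rw [hlow, hcard, harc] at h'
    simp only [mem_compl] at h'
    simp only [hSm, hTm, hr, ite_self, sum_const_zero, not_true_eq_false, and_true, true_and,
      false_and, and_false, if_false, ite_not]
    linarith
  -- With the root outside, it is the negative Hall condition for the parts inside `X`.
  · set R : Finset V := univ.filter fun u => u ∈ P.uncolored ∧ some (.inl u) ∈ X with hR
    have h := negHall_of_families D hk₀ hC hN (R := R) (fun u hu => (mem_filter.1 hu).2.1) S T
    have h' : (R.card : ℝ) ≤ (arcCount (Arc₂ D hk₀) R Sᶜ : ℝ)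
        + (∑ f, if f ∈ S ∧ f.2 ∈ Tᶜ then fCap (D.part 0).card f else 0)
        + ((∑ i ∈ T, upperNeed P hk₀ i : ℤ) : ℝ) := by
      rw [← hcap]
      exact_mod_cast h
    have hup : ((∑ i ∈ T, upperNeed P hk₀ i : ℤ) : ℝ)
        = ∑ i, if i ∈ T then (upperNeed P hk₀ i : ℝ) else 0 := by
      push_cast
      simp
    have hcard : (R.card : ℝ)
        = ∑ u, if some (.inl u) ∈ X then if u ∈ P.uncolored then 1 else 0 else 0 := by
      rw [hR, card_filter]
      push_cast
      refine sum_congr rfl fun u _ => ?_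
      by_cases h1 : some (.inl u) ∈ X <;> simp [h1]
    have harc : (arcCount (Arc₂ D hk₀) R Sᶜ : ℝ) = ∑ u, ∑ f,
        if some (.inl u) ∈ X ∧ f ∉ S then
          if u ∈ P.uncolored ∧ Arc₂ D hk₀ u f then (1 : ℝ) else 0 else 0 := by
      rw [arcCount_eq_sum]
      refine sum_congr rfl fun u _ => sum_congr rfl fun f _ => ?_
      rw [← ite_and]
      simp only [hR, mem_filter, mem_univ, true_and, mem_compl]
      congr 1
      apply propext
      tauto
    rw [hup, hcard, harc] at h'
    simp only [mem_compl] at h'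
    simp only [hSm, hTm, hr, ite_self, sum_const_zero, not_false_eq_true, and_true, true_and,
      false_and, and_false, if_false]
    linarith

theorem exists_isRouting_of_families (hP : FamilyPos D hk₀) (hC : FamilyClique D hk₀)
    (hN : FamilyNeg D hk₀) : ∃ x, IsRouting D hk₀ x := by
  classical
  obtain ⟨x, hb, he⟩ := exists_circulation arcSrc arcTgt (arcLo P hk₀) (arcUp D hk₀)
    (arcLo_le_arcUp D hk₀) (fun X => by
      convert cut_of_families D hk₀ hP hC hN X)
  -- Zero excess at the vertices, the nodes of `F` and the colors identifies row sums, column sums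
  -- and color totals with single arc values, whose bounds are the required ones.
  have hu : ∀ u, ∑ f, x (.inl (u, f)) = x (.inr (.inr (.inr u))) := by
    intro u
    have h := he (some (.inl u))
    rw [excess, sum_arc] at h
    simp [arcSrc, arcTgt] at h
    linarith
  have hf : ∀ f, ∑ u, x (.inl (u, f)) = x (.inr (.inl f)) := by
    intro f
    have h := he (some (.inr (.inl f)))
    rw [excess, sum_arc] at h
    simp [arcSrc, arcTgt] at h
    linarith
  have hi : ∀ i, ∑ f : FNode l k₀ with f.2 = i, x (.inr (.inl f)) = x (.inr (.inr (.inl i))) := by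
    intro i
    have h := he (some (.inr (.inr i)))
    rw [excess, sum_arc] at h
    simp [arcSrc, arcTgt] at h
    rw [sum_filter]
    linarith
  refine ⟨fun u f => x (.inl (u, f)), ⟨fun u f => (hb (.inl (u, f))).1, ?_, ?_, ?_, ?_, ?_⟩⟩
  · intro u f h
    have h1 := hb (.inl (u, f))
    simp only [arcLo, arcUp, if_neg h] at h1
    exact le_antisymm h1.2 h1.1
  · intro u huU
    have h1 := hb (.inr (.inr (.inr u)))
    simp only [arcLo, arcUp, if_pos huU] at h1
    rw [hu]
    exact le_antisymm h1.2 h1.1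
  · intro f hf0
    have h1 := (hb (.inr (.inl f))).2
    simp only [arcUp, fCap, if_neg hf0] at h1
    rw [hf]
    exact h1
  · intro i
    simp only [hf, hi]
    exact (hb (.inr (.inr (.inl i)))).1
  · intro i
    simp only [hf, hi]
    exact (hb (.inr (.inr (.inl i)))).2

end Sufficiency

end Routing

end EquitableFlow

theorem mainTheorem4 {V : Type*} [Fintype V] {G : SimpleGraph V} {k l k₀ : ℕ}
    (P : EquitableFlow.PartialColoring G k) (D : EquitableFlow.Decomposition P l)
    (hk₀_pos : 1 ≤ k₀) (hkk₀ : k ≤ k₀) (hk₀ : k₀ ≤ Fintype.card V) :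
    -- every positive Hall condition with `T_+ ≠ ∅` is dominated by one for a restricted choice
    (∀ (R : Finset V) (S : Finset (EquitableFlow.FNode l k₀)) (T : Finset (Fin k₀)),
      R ⊆ P.uncolored → T.Nonempty →
      ∃ S' : Finset (EquitableFlow.FNode l k₀), EquitableFlow.PosChoice S' T ∧
        EquitableFlow.posHallRhs D hk₀ (EquitableFlow.posR D hk₀ S') S' T
          ≤ EquitableFlow.posHallRhs D hk₀ R S T) ∧
    -- for a restricted choice the positive Hall condition boils down to the reduced one
    (∀ (S : Finset (EquitableFlow.FNode l k₀)) (T : Finset (Fin k₀)),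
      EquitableFlow.PosChoice S T →
      (0 ≤ EquitableFlow.posHallRhs D hk₀ (EquitableFlow.posR D hk₀ S) S T ↔
        EquitableFlow.PosCondition D hk₀ S T)) ∧
    -- hence the positive Hall conditions all hold iff the first family holds
    ((∀ (R : Finset V) (S : Finset (EquitableFlow.FNode l k₀)) (T : Finset (Fin k₀)),
      R ⊆ P.uncolored → 0 ≤ EquitableFlow.posHallRhs D hk₀ R S T) ↔
      EquitableFlow.FamilyPos D hk₀) ∧
    -- the three families together characterize feasibility of the flow problem
    (EquitableFlow.Feasible D hk₀ ↔
      EquitableFlow.FamilyPos D hk₀ ∧ EquitableFlow.FamilyClique D hk₀ ∧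
        EquitableFlow.FamilyNeg D hk₀) := by
  refine ⟨fun R S T _ hT => EquitableFlow.exists_posChoice_le D hk₀ R S hT,
    fun S T h => EquitableFlow.posHall_iff_posCondition D hk₀ h,
    EquitableFlow.posHall_iff_familyPos D hk₀, ?_⟩
  rw [EquitableFlow.feasible_iff_exists_isRouting]
  exact ⟨fun ⟨x, hx⟩ => ⟨hx.familyPos, hx.familyClique, hx.familyNeg⟩,
    fun ⟨hP, hC, hN⟩ => EquitableFlow.exists_isRouting_of_families D hk₀ hP hC hN⟩
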